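/- Consider a commutative diagram of $C^*$-algebras and $*$-homomorphisms $$\begin{array}{ccccccccc} 0&\to& A_1&\to& A_2&\xrightarrow{\;r\;}& A_3&\to&0\\ &&\downarrow&&\downarrow&&\downarrow&&\\ 0&\to& B_1&\to& B_2&\xrightarrow{\;\eta\;}& B_3&\to&0\\ &&\downarrow&&\downarrow{\scriptstyle\sigma}&&\downarrow{\scriptstyle\gamma}&&\\ 0&\to& C_1&\to& C_2&\xrightarrow{\;\eta_C\;}& C_3&\to&0 \end{array}$$ whose rows and columns (each completed by zeros at both ends) are short exact sequences, where $B_2,B_3,C_2,C_3$ are unital and $\sigma,\eta,\eta_C,\gamma$ are unit preserving. Let $\delta:K_1(C_2)\to K_0(A_2)$ be the connecting map in $K$-theory of the middle column $0\to A_2\to B_2\xrightarrow{\sigma} C_2\to 0$, and let $$\sigma_{diag}=\sigma\oplus\eta:\ B_2\to C_2\oplus_{C_3}B_3=\{(c,b)\in C_2\times B_3:\ \eta_C(c)=\gamma(b)\}.$$ All these homomorphisms are applied entrywise to matrices. Let $T\in B_2$ be such that $\sigma(T)$ is invertible in $C_2$. Then the following are equivalent: 1. $K_0(r)(\delta[\sigma(T)]_1)=0$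 in $K_0(A_3)$; 2. there are $N>0$ and $T'\in M_N(B_2)$ such that $\sigma(T')$ is invertible in $M_N(C_2)$, $[\sigma(T)]_1=[\sigma(T')]_1$ in $K_1(C_2)$, and $\eta(T')$ is invertible in $M_N(B_3)$. Moreover, for every $T'$ as in (2), $\sigma_{diag}(T')$ is invertible in $M_N(C_2\oplus_{C_3}B_3)$. -/

import Mathlib

namespace KTheory
noncomputable section
open Matrix

/-! ### The group `K₀` -/

section Idempotents

variable {R : Type*} [Ring R]

/-- (Algebraic Murray-von Neumann) equivalence of idempotent matrices, possibly of different sizes: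
`e = a b` and `f = b a` for some rectangular matrices `a`, `b`. -/
def AlgEquivalent {ι κ : Type*} [Fintype ι] [Fintype κ]
    (e : Matrix ι ι R) (f : Matrix κ κ R) : Prop :=
  ∃ (a : Matrix ι κ R) (b : Matrix κ ι R), a * b = e ∧ b * a = f

theorem AlgEquivalent.refl {ι : Type*} [Fintype ι] {e : Matrix ι ι R}
    (he : IsIdempotentElem e) : AlgEquivalent e e := ⟨e, e, he, he⟩

theorem AlgEquivalent.symm {ι κ : Type*} [Fintype ι] [Fintype κ]
    {e : Matrix ι ι R} {f : Matrix κ κ R} (h : AlgEquivalent e f) : AlgEquivalent f e := by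
  obtain ⟨a, b, h1, h2⟩ := h
  exact ⟨b, a, h2, h1⟩

theorem AlgEquivalent.trans {ι κ l : Type*} [Fintype ι] [Fintype κ] [Fintype l]
    {e : Matrix ι ι R} {f : Matrix κ κ R} {g : Matrix l l R}
    (he : IsIdempotentElem e) (hg : IsIdempotentElem g)
    (h : AlgEquivalent e f) (h' : AlgEquivalent f g) : AlgEquivalent e g := by
  obtain ⟨a, b, h1, h2⟩ := h
  obtain ⟨c, d, h3, h4⟩ := h'
  refine ⟨a * c, d * b, ?_, ?_⟩
  · calc a * c * (d * b) = a * (c * d) * b := by simp only [Matrix.mul_assoc]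
      _ = (a * b) * (a * b) := by rw [h3, ← h2]; simp only [Matrix.mul_assoc]
      _ = e := by rw [h1]; exact he
  · calc d * b * (a * c) = d * (b * a) * c := by simp only [Matrix.mul_assoc]
      _ = (d * c) * (d * c) := by rw [h2, ← h3]; simp only [Matrix.mul_assoc]
      _ = g := by rw [h4]; exact hg

theorem AlgEquivalent.reindex {ι κ : Type*} [Fintype ι] [Fintype κ] [DecidableEq ι]
    [DecidableEq κ] {e : Matrix ι ι R} (he : IsIdempotentElem e) (s : ι ≃ κ) :
    AlgEquivalent e (Matrix.reindex s s e) := by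
  refine ⟨e.submatrix id s.symm, e.submatrix s.symm id, ?_, ?_⟩
  · rw [Matrix.submatrix_mul_equiv, he]; simp
  · rw [← Matrix.submatrix_mul _ _ _ _ _ Function.bijective_id, he]; rfl

theorem AlgEquivalent.map {S : Type*} [Ring S] (φ : R →+* S) {ι κ : Type*} [Fintype ι] [Fintype κ]
    {e : Matrix ι ι R} {f : Matrix κ κ R} (h : AlgEquivalent e f) :
    AlgEquivalent (e.map φ) (f.map φ) := by
  obtain ⟨a, b, rfl, rfl⟩ := h
  exact ⟨a.map φ, b.map φ, (Matrix.map_mul ..).symm, (Matrix.map_mul ..).symm⟩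

theorem isIdempotentElem_fromBlocks {ι κ : Type*} [Fintype ι] [Fintype κ]
    {e : Matrix ι ι R} {f : Matrix κ κ R} (he : IsIdempotentElem e) (hf : IsIdempotentElem f) :
    IsIdempotentElem (fromBlocks e 0 0 f) := by
  simp [IsIdempotentElem, fromBlocks_multiply, he.eq, hf.eq]

theorem isIdempotentElem_reindex {ι κ : Type*} [Fintype ι] [Fintype κ]
    {e : Matrix ι ι R} (he : IsIdempotentElem e) (s : ι ≃ κ) :
    IsIdempotentElem (Matrix.reindex s s e) := by
  simp [IsIdempotentElem, he.eq]

theorem isIdempotentElem_map {S : Type*} [Ring S] (φ : R →+* S) {ι : Type*} [Fintype ι]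
    {e : Matrix ι ι R} (he : IsIdempotentElem e) : IsIdempotentElem (e.map φ) := by
  rw [IsIdempotentElem, ← Matrix.map_mul, he.eq]

theorem AlgEquivalent.fromBlocks {ι κ ι' κ' : Type*} [Fintype ι] [Fintype κ] [Fintype ι']
    [Fintype κ'] {e : Matrix ι ι R} {f : Matrix κ κ R} {e' : Matrix ι' ι' R} {f' : Matrix κ' κ' R}
    (h : AlgEquivalent e f) (h' : AlgEquivalent e' f') :
    AlgEquivalent (fromBlocks e 0 0 e') (fromBlocks f 0 0 f') := by
  obtain ⟨a, b, rfl, rfl⟩ := h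
  obtain ⟨c, d, rfl, rfl⟩ := h'
  exact ⟨Matrix.fromBlocks a 0 0 c, Matrix.fromBlocks b 0 0 d, by simp [fromBlocks_multiply],
    by simp [fromBlocks_multiply]⟩

theorem AlgEquivalent.add {ι : Type*} [Fintype ι] [DecidableEq ι] {e f : Matrix ι ι R}
    (he : IsIdempotentElem e) (hf : IsIdempotentElem f) (h : e * f = 0) (h' : f * e = 0) :
    AlgEquivalent (e + f) (Matrix.fromBlocks e 0 0 f) := by
  refine ⟨fromCols e f, fromRows e f, ?_, ?_⟩
  · rw [fromCols_mul_fromRows, he.eq, hf.eq]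
  · rw [fromRows_mul_fromCols, he.eq, hf.eq, h, h']

variable (R) in
/-- The setoid of equivalence of idempotents in `M_∞(R) = ⋃ₙ Mₙ(R)`. -/
@[reducible]
def idempotentSetoid : Setoid (Σ n : ℕ, {e : Matrix (Fin n) (Fin n) R // IsIdempotentElem e}) where
  r x y := AlgEquivalent x.2.1 y.2.1
  iseqv := ⟨fun x => .refl x.2.2, fun h => h.symm, fun {x _ z} h h' => .trans x.2.2 z.2.2 h h'⟩

variable (R) in
/-- The abelian monoid `V(R)` of equivalence classes of idempotents in `M_∞(R)`, with addition
`[e] + [f] = [diag(e, f)]`. For a C*-algebra this is the same monoid as the one made of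
self-adjoint projections up to Murray-von Neumann equivalence. -/
def V : Type _ := Quotient (idempotentSetoid R)

/-- The class in `V(R)` of an idempotent matrix indexed by an arbitrary finite type. -/
def V.mk {ι : Type*} [Fintype ι] (e : Matrix ι ι R) (he : IsIdempotentElem e) : V R :=
  Quotient.mk (idempotentSetoid R) ⟨Fintype.card ι,
    Matrix.reindex (Fintype.equivFin ι) (Fintype.equivFin ι) e, isIdempotentElem_reindex he _⟩

theorem V.mk_eq_mk {ι κ : Type*} [Fintype ι] [Fintype κ]
    {e : Matrix ι ι R} {f : Matrix κ κ R} {he : IsIdempotentElem e} {hf : IsIdempotentElem f} :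
    V.mk e he = V.mk f hf ↔ AlgEquivalent e f := by
  classical
  have he' := isIdempotentElem_reindex he (Fintype.equivFin ι)
  have hf' := isIdempotentElem_reindex hf (Fintype.equivFin κ)
  constructor
  · intro h
    exact ((AlgEquivalent.reindex he _).trans he hf' (Quotient.exact h)).trans he hf
      (AlgEquivalent.reindex hf _).symm
  · intro h
    exact Quotient.sound (s := idempotentSetoid R)
      (((AlgEquivalent.reindex he _).symm.trans he' hf h).trans he' hf' (AlgEquivalent.reindex hf _))

theorem V.ind {p : V R → Prop}
    (h : ∀ (n : ℕ) (e : Matrix (Fin n) (Fin n) R) (he : IsIdempotentElem e), p (V.mk e he))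
    (x : V R) : p x := by
  obtain ⟨⟨n, e, he⟩⟩ := x
  have : (Quotient.mk (idempotentSetoid R) ⟨n, e, he⟩ : V R) = V.mk e he :=
    Quotient.sound (s := idempotentSetoid R) (AlgEquivalent.reindex he (Fintype.equivFin _))
  exact this.symm.subst (motive := p) (h n e he)

instance : Zero (V R) := ⟨V.mk (0 : Matrix (Fin 0) (Fin 0) R) IsIdempotentElem.zero⟩

instance : Add (V R) :=
  ⟨Quotient.map₂ (sa := idempotentSetoid R) (sb := idempotentSetoid R) (sc := idempotentSetoid R)
    (fun x y => ⟨x.1 + y.1, Matrix.reindex finSumFinEquiv finSumFinEquiv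
      (Matrix.fromBlocks x.2.1 0 0 y.2.1),
      isIdempotentElem_reindex (isIdempotentElem_fromBlocks x.2.2 y.2.2) _⟩)
    (fun x x' h y y' h' =>
      ((AlgEquivalent.reindex (isIdempotentElem_fromBlocks x.2.2 y.2.2) finSumFinEquiv).symm.trans
        (isIdempotentElem_reindex (isIdempotentElem_fromBlocks x.2.2 y.2.2) _)
        (isIdempotentElem_fromBlocks x'.2.2 y'.2.2) (h.fromBlocks h')).trans
        (isIdempotentElem_reindex (isIdempotentElem_fromBlocks x.2.2 y.2.2) _)
        (isIdempotentElem_reindex (isIdempotentElem_fromBlocks x'.2.2 y'.2.2) _)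
        (AlgEquivalent.reindex (isIdempotentElem_fromBlocks x'.2.2 y'.2.2) _))⟩

theorem V.mk_add_mk {ι κ : Type*} [Fintype ι] [Fintype κ]
    {e : Matrix ι ι R} {f : Matrix κ κ R} (he : IsIdempotentElem e) (hf : IsIdempotentElem f) :
    V.mk e he + V.mk f hf = V.mk (fromBlocks e 0 0 f) (isIdempotentElem_fromBlocks he hf) := by
  classical
  have he' := isIdempotentElem_reindex he (Fintype.equivFin ι)
  have hf' := isIdempotentElem_reindex hf (Fintype.equivFin κ)
  have h1 := isIdempotentElem_fromBlocks he hf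
  have h2 := isIdempotentElem_fromBlocks he' hf'
  refine Quotient.sound (s := idempotentSetoid R) ?_
  exact ((AlgEquivalent.reindex h2 finSumFinEquiv).symm.trans (isIdempotentElem_reindex h2 _)
    h1 ((AlgEquivalent.reindex he _).symm.fromBlocks (AlgEquivalent.reindex hf _).symm)).trans
    (isIdempotentElem_reindex h2 _) (isIdempotentElem_reindex h1 _)
    (AlgEquivalent.reindex h1 _)

instance : AddCommMonoid (V R) where
  add_assoc := by
    refine V.ind fun n e he => V.ind fun m f hf => V.ind fun k g hg => ?_
    simp only [V.mk_add_mk]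
    rw [V.mk_eq_mk]
    have h := AlgEquivalent.reindex (isIdempotentElem_fromBlocks
      (isIdempotentElem_fromBlocks he hf) hg) (Equiv.sumAssoc (Fin n) (Fin m) (Fin k))
    convert h using 1
    ext (i | i | i) (j | j | j) <;> rfl
  zero_add := by
    refine V.ind fun n e he => ?_
    change V.mk _ _ + _ = _
    rw [V.mk_add_mk, V.mk_eq_mk]
    have h := AlgEquivalent.reindex (isIdempotentElem_fromBlocks (R := R)
      (IsIdempotentElem.zero (M₀ := Matrix (Fin 0) (Fin 0) R)) he) (Equiv.emptySum (Fin 0) (Fin n))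
    convert h using 1
    ext i j
    simp
  add_zero := by
    refine V.ind fun n e he => ?_
    change _ + V.mk _ _ = _
    rw [V.mk_add_mk, V.mk_eq_mk]
    have h := AlgEquivalent.reindex (isIdempotentElem_fromBlocks (R := R)
      he (IsIdempotentElem.zero (M₀ := Matrix (Fin 0) (Fin 0) R))) (Equiv.sumEmpty (Fin n) (Fin 0))
    convert h using 1
    ext i j
    simp
  add_comm := by
    refine V.ind fun n e he => V.ind fun m f hf => ?_
    rw [V.mk_add_mk, V.mk_add_mk, V.mk_eq_mk]
    have h := AlgEquivalent.reindex (isIdempotentElem_fromBlocks he hf)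
      (Equiv.sumComm (Fin n) (Fin m))
    convert h using 1
    ext (i | i) (j | j) <;> rfl
  nsmul := nsmulRec

/-- Functoriality of `V`, by applying a ring homomorphism entrywise. -/
def V.map {S : Type*} [Ring S] (φ : R →+* S) : V R →+ V S where
  toFun := Quotient.map (sa := idempotentSetoid R) (sb := idempotentSetoid S)
    (fun x => ⟨x.1, x.2.1.map φ, isIdempotentElem_map φ x.2.2⟩) (fun _ _ h => h.map φ)
  map_zero' := by
    change V.mk ((0 : Matrix (Fin 0) (Fin 0) R).map φ) (isIdempotentElem_map φ .zero) =
      V.mk (0 : Matrix (Fin 0) (Fin 0) S) .zero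
    congr 1
    ext i
    exact i.elim0
  map_add' := by
    refine V.ind fun n e he => V.ind fun m f hf => ?_
    rw [V.mk_add_mk]
    change V.mk ((Matrix.fromBlocks e 0 0 f).map φ) (isIdempotentElem_map φ (isIdempotentElem_fromBlocks he hf)) =
      V.mk (e.map φ) (isIdempotentElem_map φ he) + V.mk (f.map φ) (isIdempotentElem_map φ hf)
    rw [V.mk_add_mk]
    congr 1
    rw [Matrix.fromBlocks_map]
    simp

theorem V.map_mk {S : Type*} [Ring S] (φ : R →+* S) {ι : Type*} [Fintype ι]
    {e : Matrix ι ι R} (he : IsIdempotentElem e) :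
    V.map φ (V.mk e he) = V.mk (e.map φ) (isIdempotentElem_map φ he) := rfl

variable (R) in
/-- The Grothendieck group of `V(R)`. -/
abbrev K₀₀ : Type _ := Algebra.GrothendieckAddGroup (V R)

/-- The class `[e]₀` of an idempotent matrix. -/
def K₀₀.mk {ι : Type*} [Fintype ι] (e : Matrix ι ι R) (he : IsIdempotentElem e) : K₀₀ R :=
  Algebra.GrothendieckAddGroup.of (V.mk e he)

/-- Functoriality of `K₀₀`. -/
def K₀₀.map {S : Type*} [Ring S] (φ : R →+* S) : K₀₀ R →+ K₀₀ S :=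
  Algebra.GrothendieckAddGroup.lift (Algebra.GrothendieckAddGroup.of.comp (V.map φ))

theorem K₀₀.map_of {S : Type*} [Ring S] (φ : R →+* S) (x : V R) :
    K₀₀.map φ (Algebra.GrothendieckAddGroup.of x) =
      Algebra.GrothendieckAddGroup.of (V.map φ x) := by
  exact DFunLike.congr_fun (Algebra.GrothendieckAddGroup.lift.symm_apply_apply
    (Algebra.GrothendieckAddGroup.of.comp (V.map φ))) x

theorem K₀₀.map_mk {S : Type*} [Ring S] (φ : R →+* S) {ι : Type*} [Fintype ι]
    {e : Matrix ι ι R} (he : IsIdempotentElem e) :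
    K₀₀.map φ (K₀₀.mk e he) = K₀₀.mk (e.map φ) (isIdempotentElem_map φ he) :=
  K₀₀.map_of φ _

theorem K₀₀.mk_congr {ι κ : Type*} [Fintype ι] [Fintype κ]
    {e : Matrix ι ι R} {f : Matrix κ κ R} (he : IsIdempotentElem e) (hf : IsIdempotentElem f)
    (h : AlgEquivalent e f) : K₀₀.mk e he = K₀₀.mk f hf := by
  rw [K₀₀.mk, V.mk_eq_mk.2 h, K₀₀.mk]

theorem K₀₀.mk_add {ι : Type*} [Fintype ι] {e f : Matrix ι ι R}
    (he : IsIdempotentElem e) (hf : IsIdempotentElem f) (hef : IsIdempotentElem (e + f))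
    (h : e * f = 0) (h' : f * e = 0) :
    K₀₀.mk (e + f) hef = K₀₀.mk e he + K₀₀.mk f hf := by
  classical
  rw [K₀₀.mk, K₀₀.mk, K₀₀.mk, ← map_add, V.mk_add_mk, V.mk_eq_mk.2 (AlgEquivalent.add he hf h h')]

theorem K₀₀.map_map {S T : Type*} [Ring S] [Ring T] (φ : R →+* S) (ψ : S →+* T) (x : K₀₀ R) :
    K₀₀.map ψ (K₀₀.map φ x) = K₀₀.map (ψ.comp φ) x := by
  have : (K₀₀.map ψ).comp (K₀₀.map φ) = K₀₀.map (ψ.comp φ) := by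
    apply Algebra.GrothendieckAddGroup.lift.symm.injective
    ext x
    change K₀₀.map ψ (K₀₀.map φ (Algebra.GrothendieckAddGroup.of x)) =
      K₀₀.map (ψ.comp φ) (Algebra.GrothendieckAddGroup.of x)
    simp only [K₀₀.map_of]
    congr 1
    revert x
    refine V.ind fun n e he => ?_
    simp only [V.map_mk]
    rfl
  exact DFunLike.congr_fun this x

end Idempotents

section K₀

variable (A : Type*) [NonUnitalCStarAlgebra A]

/-- `K₀(A)` of a (not necessarily unital) C*-algebra: the kernel of `K₀₀(A~) → K₀₀(ℂ)`, where
`A~` is the C*-algebra `A` with a unit adjoined. -/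
def K₀ : Type _ := (K₀₀.map (Unitization.fstHom ℂ A : Unitization ℂ A →+* ℂ)).ker

instance : AddCommGroup (K₀ A) :=
  inferInstanceAs (AddCommGroup (K₀₀.map (Unitization.fstHom ℂ A : Unitization ℂ A →+* ℂ)).ker)

variable {A} {A' : Type*} [NonUnitalCStarAlgebra A']

/-- The map `K₀(φ) : K₀(A) → K₀(A')` of a *-homomorphism, induced by `A~ → A'~`. -/
def K₀.map (φ : A →⋆ₙₐ[ℂ] A') : K₀ A →+ K₀ A' :=
  ((K₀₀.map (Unitization.starMap φ : Unitization ℂ A →+* Unitization ℂ A')).comp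
    (AddSubgroup.subtype _)).codRestrict _ fun x => by
      rw [AddMonoidHom.mem_ker, AddMonoidHom.comp_apply, K₀₀.map_map]
      have : (Unitization.fstHom ℂ A' : Unitization ℂ A' →+* ℂ).comp
          (Unitization.starMap φ : Unitization ℂ A →+* Unitization ℂ A') =
          (Unitization.fstHom ℂ A : Unitization ℂ A →+* ℂ) := by
        ext x
        induction x with
        | _ r a => simp [Unitization.algebraMap_eq_inl]
      rw [this]
      exact x.2

end K₀

section K₁

section Stabilization

variable (R : Type*) [Ring R] {n m k : ℕ}

/-- The inclusion `Rⁿ → Rᵐ` onto the first `n` coordinates, as a 0-1 matrix. -/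
def incl (h : n ≤ m) : Matrix (Fin m) (Fin n) R := (1 : Matrix (Fin m) (Fin m) R).submatrix id (Fin.castLE h)

/-- The projection `Rᵐ → Rⁿ` to the first `n` coordinates, as a 0-1 matrix. -/
def proj (h : n ≤ m) : Matrix (Fin n) (Fin m) R := (1 : Matrix (Fin m) (Fin m) R).submatrix (Fin.castLE h) id

theorem proj_mul_incl (h : n ≤ m) : proj R h * incl R h = 1 := by
  rw [proj, incl, ← Matrix.submatrix_mul _ _ _ _ _ Function.bijective_id, mul_one,
    Matrix.submatrix_one _ (Fin.castLE_injective h)]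

theorem incl_mul_incl (h : n ≤ m) (h' : m ≤ k) :
    incl R h' * incl R h = incl R (h.trans h') := by
  ext i j
  simp [incl, Matrix.mul_apply, Matrix.one_apply]

theorem proj_mul_proj (h : n ≤ m) (h' : m ≤ k) :
    proj R h * proj R h' = proj R (h.trans h') := by
  ext i j
  simp only [proj, Matrix.mul_apply, Matrix.submatrix_apply, Matrix.one_apply, id]
  rw [Finset.sum_eq_single (Fin.castLE h i)]
  · simp
  · intro l _ hl
    simp [hl.symm]
  · simp

variable {R}

theorem incl_map {S : Type*} [Ring S] (φ : R →+* S) (h : n ≤ m) :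
    (incl R h).map φ = incl S h := by
  rw [incl, incl, ← Matrix.submatrix_map, Matrix.map_one _ (map_zero φ) (map_one φ)]

theorem proj_map {S : Type*} [Ring S] (φ : R →+* S) (h : n ≤ m) :
    (proj R h).map φ = proj S h := by
  rw [proj, proj, ← Matrix.submatrix_map, Matrix.map_one _ (map_zero φ) (map_one φ)]

theorem compress_mul {ι κ : Type*} [Fintype ι] [Fintype κ] [DecidableEq ι] [DecidableEq κ]
    {F : Matrix κ ι R} {G : Matrix ι κ R} (hFG : G * F = 1) (u v : Matrix ι ι R) :
    (F * u * G + (1 - F * G)) * (F * v * G + (1 - F * G)) = F * (u * v) * G + (1 - F * G) := by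
  have h1 : ∀ X : Matrix ι κ R, G * (F * X) = X := fun X => by
    rw [← Matrix.mul_assoc, hFG, Matrix.one_mul]
  simp only [Matrix.mul_add, Matrix.add_mul, Matrix.mul_sub, Matrix.sub_mul, Matrix.mul_one,
    Matrix.one_mul, Matrix.mul_assoc, h1]
  abel

/-- `u ↦ diag(u, 1, …, 1)`, from `Mₙ(R)` to `Mₘ(R)`. -/
def stabilize (h : n ≤ m) : Matrix (Fin n) (Fin n) R →* Matrix (Fin m) (Fin m) R where
  toFun u := incl R h * u * proj R h + (1 - incl R h * proj R h)
  map_one' := by simp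
  map_mul' u v := (compress_mul (proj_mul_incl R h) u v).symm

theorem stabilize_apply (h : n ≤ m) (u : Matrix (Fin n) (Fin n) R) :
    stabilize h u = incl R h * u * proj R h + (1 - incl R h * proj R h) := rfl

theorem stabilize_self (u : Matrix (Fin n) (Fin n) R) : stabilize le_rfl u = u := by
  have h1 : incl R (le_refl n) = 1 := rfl
  have h2 : proj R (le_refl n) = 1 := rfl
  simp [stabilize_apply, h1, h2]

theorem stabilize_stabilize (h : n ≤ m) (h' : m ≤ k) (u : Matrix (Fin n) (Fin n) R) :
    stabilize h' (stabilize h u) = stabilize (h.trans h') u := by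
  simp only [stabilize_apply, ← incl_mul_incl R h h', ← proj_mul_proj R h h', Matrix.mul_add,
    Matrix.add_mul, Matrix.mul_sub, Matrix.sub_mul, Matrix.mul_one, Matrix.mul_assoc]
  abel

theorem stabilize_map {S : Type*} [Ring S] (φ : R →+* S) (h : n ≤ m)
    (u : Matrix (Fin n) (Fin n) R) : (stabilize h u).map φ = stabilize h (u.map φ) := by
  simp only [stabilize_apply, Matrix.map_add φ (map_add φ), Matrix.map_sub φ (map_sub φ),
    Matrix.map_mul, incl_map, proj_map, Matrix.map_one _ (map_zero φ) (map_one φ)]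

end Stabilization

variable (R : Type*) [Ring R] [TopologicalSpace R] [IsTopologicalRing R]

/-- `GLₙ(R)`, with the topology of the group of units of `Mₙ(R)`. -/
abbrev MatGL (n : ℕ) : Type _ := (Matrix (Fin n) (Fin n) R)ˣ

/-- The connected component `GLₙ(R)₀` of the identity. -/
abbrev MatGL₀ (n : ℕ) : Subgroup (MatGL R n) := Subgroup.connectedComponentOfOne (MatGL R n)

variable {R}

instance MatGL₀_normal (n : ℕ) : (MatGL₀ R n).Normal where
  conj_mem u hu g := by
    have hc : Continuous fun x : MatGL R n => g * x * g⁻¹ := by fun_prop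
    have := hc.image_connectedComponent_subset 1 ⟨u, hu, rfl⟩
    rwa [mul_one, mul_inv_cancel] at this

theorem continuous_stabilize {n m : ℕ} (h : n ≤ m) :
    Continuous (stabilize (R := R) h) := by
  change Continuous fun u : Matrix (Fin n) (Fin n) R => incl R h * u * proj R h + (1 - incl R h * proj R h)
  fun_prop

/-- `GLₙ(R) → GLₘ(R)`, `u ↦ diag(u, 1, …, 1)`. -/
def MatGL.stabilize {n m : ℕ} (h : n ≤ m) : MatGL R n →* MatGL R m := Units.map (KTheory.stabilize h)

theorem MatGL.stabilize_mem {n m : ℕ} (h : n ≤ m) :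
    MatGL₀ R n ≤ (MatGL₀ R m).comap (MatGL.stabilize h) := by
  intro u hu
  have hc : Continuous (MatGL.stabilize (R := R) h) := (continuous_stabilize h).units_map _
  have := hc.image_connectedComponent_subset 1 ⟨u, hu, rfl⟩
  rwa [map_one] at this

/-- The map `GLₙ(R)/GLₙ(R)₀ → GLₘ(R)/GLₘ(R)₀` induced by `u ↦ diag(u, 1, …, 1)`. -/
def compStab {n m : ℕ} (h : n ≤ m) : MatGL R n ⧸ MatGL₀ R n →* MatGL R m ⧸ MatGL₀ R m :=
  QuotientGroup.map _ _ (MatGL.stabilize h) (MatGL.stabilize_mem h)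

instance : DirectedSystem (fun n : ℕ => MatGL R n ⧸ MatGL₀ R n)
    (fun _ _ h => compStab (R := R) h) where
  map_self n x := by
    induction x using QuotientGroup.induction_on with | _ u => ?_
    exact congrArg _ (Units.ext (stabilize_self _))
  map_map i j k hij hjk x := by
    induction x using QuotientGroup.induction_on with | _ u => ?_
    exact congrArg _ (Units.ext (stabilize_stabilize _ _ _))

variable (R) in
/-- `K₁(R) = lim GLₙ(R)/GLₙ(R)₀` for a unital C*-algebra `R`; the group law is written
multiplicatively. -/
def K₁ : Type _ :=
  DirectLimit (fun n : ℕ => MatGL R n ⧸ MatGL₀ R n) (fun _ _ h => compStab (R := R) h)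

instance : Group (K₁ R) := inferInstanceAs (Group
  (DirectLimit (fun n : ℕ => MatGL R n ⧸ MatGL₀ R n) (fun _ _ h => compStab (R := R) h)))

/-- The class `[u]₁` of an invertible matrix `u`. -/
def K₁.mk {n : ℕ} (u : MatGL R n) : K₁ R :=
  Quotient.mk (DirectLimit.setoid fun _ _ h => compStab (R := R) h) ⟨n, QuotientGroup.mk u⟩

/-- The class `[c]₁` of an invertible element `c`, seen as a 1 × 1 matrix. -/
def K₁.ofUnit (c : Rˣ) : K₁ R :=
  K₁.mk (n := 1) (Units.map (Matrix.scalar (Fin 1) : R →+* Matrix (Fin 1) (Fin 1) R).toMonoidHom c)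

end K₁

section Connecting

/-- The sequence `0 → X → Y → Z → 0` is exact. -/
structure IsShortExact {X Y Z : Type*} [Zero Z] (f : X → Y) (g : Y → Z) : Prop where
  injective : Function.Injective f
  exact : Function.Exact f g
  surjective : Function.Surjective g

variable {J B C : Type*} [NonUnitalCStarAlgebra J] [CStarAlgebra B] [CStarAlgebra C]
  {φ : J →⋆ₙₐ[ℂ] B} {σ : B →⋆ₐ[ℂ] C}

theorem exists_lift_of_mem_MatGL₀ (hσ : Function.Surjective σ) {n : ℕ} {c : MatGL C n}
    (hc : c ∈ MatGL₀ C n) : ∃ b : MatGL B n, (b : Matrix (Fin n) (Fin n) B).map σ = c := by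
  let f : Matrix (Fin n) (Fin n) B →* Matrix (Fin n) (Fin n) C :=
    ((σ : B →+* C).mapMatrix : Matrix (Fin n) (Fin n) B →+* Matrix (Fin n) (Fin n) C)
  suffices h : MatGL₀ C n ≤ (Units.map f).range by
    obtain ⟨b, hb⟩ := h hc
    exact ⟨b, congrArg Units.val hb⟩
  have hσo : IsOpenMap σ := by
    let σ' : B →L[ℂ] C := ⟨((σ : B →ₐ[ℂ] C) : B →ₗ[ℂ] C),
      (NonUnitalStarAlgHom.instContinuousLinearMapClassComplex (F := B →⋆ₐ[ℂ] C)).map_continuous σ⟩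
    exact σ'.isOpenMap hσ
  have hfo : IsOpenMap f := by
    have h1 : IsOpenMap (fun (M : Fin n → Fin n → B) (i j : Fin n) => σ (M i j)) := by
      refine IsOpenMap.piMap (f := fun _ : Fin n => fun (v : Fin n → B) (j : Fin n) => σ (v j)) ?_ ?_
      · exact fun _ => IsOpenMap.piMap (f := fun _ : Fin n => σ) (fun _ => hσo) (.of_forall fun _ => hσ)
      · exact .of_forall fun _ => Function.Surjective.piMap (f := fun _ : Fin n => σ) fun _ => hσ
    exact h1
  have hU : IsOpen {x : Matrix (Fin n) (Fin n) B | IsUnit x} := by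
    let _ := CStarAlgebra.spectralOrder B
    let _ := CStarAlgebra.spectralOrderedRing B
    exact Units.isOpen (R := CStarMatrix (Fin n) (Fin n) B)
  have hopen : IsOpen ((Units.map f).range : Set (MatGL C n)) := by
    refine Subgroup.isOpen_of_mem_nhds _ (g := 1) ?_
    have h2 : IsOpen ((Units.val : MatGL C n → _) ⁻¹' (f '' {x | IsUnit x})) :=
      (hfo _ hU).preimage Units.continuous_val
    refine Filter.mem_of_superset (h2.mem_nhds ⟨1, isUnit_one, map_one f⟩) ?_
    rintro x ⟨_, ⟨b, rfl⟩, hb⟩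
    exact ⟨b, Units.ext hb⟩
  have hclopen : IsClopen ((Units.map f).range : Set (MatGL C n)) :=
    ⟨Subgroup.isClosed_of_isOpen _ hopen, hopen⟩
  exact hclopen.connectedComponent_subset (one_mem _)

/-- The unital map `J~ → B`, `λ + x ↦ λ 1 + φ x`. -/
abbrev unitizationHom (φ : J →⋆ₙₐ[ℂ] B) : Unitization ℂ J →+* B :=
  (Unitization.starLift φ : _ →⋆ₐ[ℂ] B)

/-- The scalar part `J~ → ℂ`, `λ + x ↦ λ`. -/
abbrev scalarHom (J : Type*) [NonUnitalCStarAlgebra J] : Unitization ℂ J →+* ℂ :=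
  Unitization.fstHom ℂ J

theorem unitization_ext (h : IsShortExact φ σ) {ι κ : Type*} {X Y : Matrix ι κ (Unitization ℂ J)}
    (h1 : X.map (scalarHom J) = Y.map (scalarHom J))
    (h2 : X.map (unitizationHom φ) = Y.map (unitizationHom φ)) : X = Y := by
  ext i j
  · exact congrFun (congrFun h1 i) j
  · have h1' : (X i j).fst = (Y i j).fst := congrFun (congrFun h1 i) j
    have h2' : algebraMap ℂ B (X i j).fst + φ (X i j).snd =
        algebraMap ℂ B (Y i j).fst + φ (Y i j).snd := congrFun (congrFun h2 i) j
    rw [h1'] at h2'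
    exact h.injective (add_left_cancel h2')

theorem exists_unitization (h : IsShortExact φ σ) {ι κ : Type*} (P : Matrix ι κ ℂ) (Q : Matrix ι κ B)
    (hPQ : Q.map σ = P.map (algebraMap ℂ C)) : ∃ X : Matrix ι κ (Unitization ℂ J),
      X.map (scalarHom J) = P ∧ X.map (unitizationHom φ) = Q := by
  have hx : ∀ i j, ∃ x : J, φ x = Q i j - algebraMap ℂ B (P i j) := fun i j => by
    refine (h.exact _).1 ?_
    have : σ (Q i j) = algebraMap ℂ C (P i j) := congrFun (congrFun hPQ i) j
    rw [map_sub, this, AlgHomClass.commutes, sub_self]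
  choose x hx using hx
  refine ⟨fun i j => ⟨(P i j, x i j)⟩, rfl, ?_⟩
  ext i j
  change algebraMap ℂ B (P i j) + φ (x i j) = Q i j
  rw [hx]
  abel

theorem exists_map_eq {B C : Type*} {σ : B → C} (hσ : Function.Surjective σ)
    {ι κ : Type*} (c : Matrix ι κ C) : ∃ b : Matrix ι κ B, b.map σ = c := by
  choose g hg using hσ
  exact ⟨c.map g, Matrix.ext fun i j => hg _⟩

/-- The idempotent `pₙ = diag(1ₙ, 0ₙ)`. -/
def corner (R : Type*) [Ring R] (n : ℕ) : Matrix (Fin n ⊕ Fin n) (Fin n ⊕ Fin n) R :=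
  fromBlocks 1 0 0 0

theorem corner_idem (R : Type*) [Ring R] (n : ℕ) : IsIdempotentElem (corner R n) :=
  isIdempotentElem_fromBlocks .one .zero

theorem corner_map {R S : Type*} [Ring R] [Ring S] (f : R →+* S) (n : ℕ) :
    (corner R n).map f = corner S n := by
  simp [corner, fromBlocks_map, Matrix.map_one _ (map_zero f) (map_one f)]

/-- `w ∈ GL₂ₙ(B)` lifts `diag(u, u⁻¹)`, and `e` is the matrix `w pₙ w⁻¹` seen in `M₂ₙ(J~)`:
its scalar part is `pₙ` and its image in `M₂ₙ(B)` is `w pₙ w⁻¹`. -/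
structure IsIndexData (φ : J →⋆ₙₐ[ℂ] B) (σ : B →⋆ₐ[ℂ] C) {n : ℕ} (u : MatGL C n)
    (w : (Matrix (Fin n ⊕ Fin n) (Fin n ⊕ Fin n) B)ˣ)
    (e : Matrix (Fin n ⊕ Fin n) (Fin n ⊕ Fin n) (Unitization ℂ J)) : Prop where
  lift : (w : Matrix (Fin n ⊕ Fin n) (Fin n ⊕ Fin n) B).map σ =
    fromBlocks (u : Matrix (Fin n) (Fin n) C) 0 0 ((u⁻¹ : MatGL C n) : Matrix (Fin n) (Fin n) C)
  scalar : e.map (scalarHom J) = corner ℂ n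
  image : e.map (unitizationHom φ) = w * corner B n * w⁻¹.val

theorem IsIndexData.isIdempotentElem (h : IsShortExact φ σ) {n : ℕ} {u : MatGL C n} {w} {e}
    (hd : IsIndexData φ σ u w e) : IsIdempotentElem e := by
  apply unitization_ext h
  · rw [Matrix.map_mul, hd.scalar, corner_idem]
  · rw [Matrix.map_mul, hd.image]
    calc _ = ↑w * corner B n * (↑w⁻¹ * ↑w) * corner B n * ↑w⁻¹ := by simp only [mul_assoc]
      _ = ↑w * (corner B n * corner B n) * ↑w⁻¹ := by simp [mul_assoc]
      _ = _ := by rw [corner_idem]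

theorem exists_isIndexData (h : IsShortExact φ σ) {n : ℕ} (u : MatGL C n) :
    ∃ w e, IsIndexData φ σ u w e := by
  obtain ⟨b, hb⟩ := exists_map_eq h.surjective (u : Matrix (Fin n) (Fin n) C)
  obtain ⟨d, hd⟩ := exists_map_eq h.surjective ((u⁻¹ : MatGL C n) : Matrix (Fin n) (Fin n) C)
  let w : (Matrix (Fin n ⊕ Fin n) (Fin n ⊕ Fin n) B)ˣ :=
    { val := fromBlocks (2 • b - b * d * b) (b * d - 1) (1 - d * b) d
      inv := fromBlocks d (1 - d * b) (b * d - 1) (2 • b - b * d * b)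
      val_inv := by
        rw [fromBlocks_multiply, ← fromBlocks_one]
        congr 1 <;> noncomm_ring
      inv_val := by
        rw [fromBlocks_multiply, ← fromBlocks_one]
        congr 1 <;> noncomm_ring }
  have hmul : ∀ X Y : Matrix (Fin n) (Fin n) B, (X * Y).map σ = X.map σ * Y.map σ := fun X Y =>
    Matrix.map_mul (f := (σ : B →+* C))
  have hone : (1 : Matrix (Fin n) (Fin n) B).map σ = 1 :=
    Matrix.map_one _ (map_zero σ) (map_one σ)
  have hw : (w : Matrix (Fin n ⊕ Fin n) (Fin n ⊕ Fin n) B).map σ =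
      fromBlocks (u : Matrix (Fin n) (Fin n) C) 0 0 ((u⁻¹ : MatGL C n) : Matrix _ _ C) := by
    simp only [w, fromBlocks_map, Matrix.map_sub σ (map_sub σ), hmul, hone, hb, hd, two_smul,
      Matrix.map_add σ (map_add σ), Units.mul_inv, Units.inv_mul, one_mul, sub_self,
      add_sub_cancel_right]
  have hw' : (w⁻¹.val : Matrix (Fin n ⊕ Fin n) (Fin n ⊕ Fin n) B).map σ =
      fromBlocks ((u⁻¹ : MatGL C n) : Matrix _ _ C) 0 0 (u : Matrix (Fin n) (Fin n) C) := by
    simp only [w, Units.inv_mk, fromBlocks_map, Matrix.map_sub σ (map_sub σ), hmul, hone, hb, hd,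
      two_smul, Matrix.map_add σ (map_add σ), Units.mul_inv, Units.inv_mul, one_mul, sub_self,
      add_sub_cancel_right]
  obtain ⟨e, he, he'⟩ := exists_unitization h (corner ℂ n) (w * corner B n * w⁻¹.val) (by
    have := corner_map (σ : B →+* C) n
    have h3 := corner_map (algebraMap ℂ C) n
    rw [h3]
    change Matrix.map _ (σ : B →+* C) = _
    rw [Matrix.map_mul, Matrix.map_mul, this]
    change Matrix.map _ σ * _ * Matrix.map _ σ = _
    rw [hw, hw', corner, fromBlocks_multiply, fromBlocks_multiply]
    simp)
  exact ⟨w, e, hw, he, he'⟩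

/-- `diag(u, v)` as an invertible matrix. -/
def diagUnit {R : Type*} [Ring R] {n : ℕ} (u v : (Matrix (Fin n) (Fin n) R)ˣ) :
    (Matrix (Fin n ⊕ Fin n) (Fin n ⊕ Fin n) R)ˣ where
  val := fromBlocks u 0 0 v
  inv := fromBlocks (u⁻¹ : _ˣ) 0 0 (v⁻¹ : _ˣ)
  val_inv := by simp [fromBlocks_multiply]
  inv_val := by simp [fromBlocks_multiply]

theorem diagUnit_mul {R : Type*} [Ring R] {n : ℕ} (u v u' v' : (Matrix (Fin n) (Fin n) R)ˣ) :
    diagUnit u v * diagUnit u' v' = diagUnit (u * u') (v * v') := by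
  ext1
  simp [diagUnit, fromBlocks_multiply]

theorem IsIndexData.algEquivalent (h : IsShortExact φ σ) {n : ℕ} {u u' : MatGL C n} {w w'} {e e'}
    (hd : IsIndexData φ σ u w e) (hd' : IsIndexData φ σ u' w' e') (hu : u⁻¹ * u' ∈ MatGL₀ C n) :
    AlgEquivalent e e' := by
  obtain ⟨b, hb⟩ := exists_lift_of_mem_MatGL₀ h.surjective hu
  obtain ⟨b', hb'⟩ := exists_lift_of_mem_MatGL₀ h.surjective
    ((MatGL₀_normal n).conj_mem _ (inv_mem hu) u)
  let q : Matrix (Fin n ⊕ Fin n) (Fin n ⊕ Fin n) B →* Matrix (Fin n ⊕ Fin n) (Fin n ⊕ Fin n) C :=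
    ((σ : B →+* C).mapMatrix : Matrix (Fin n ⊕ Fin n) (Fin n ⊕ Fin n) B →+* _)
  have hq : Units.map q w = diagUnit u u⁻¹ := Units.ext hd.lift
  have hq' : Units.map q w' = diagUnit u' u'⁻¹ := Units.ext hd'.lift
  have hqD : Units.map q (diagUnit b b') = diagUnit (u⁻¹ * u') (u * (u⁻¹ * u')⁻¹ * u⁻¹) := by
    ext1
    change (fromBlocks b.val 0 0 b'.val).map σ = _
    rw [fromBlocks_map, hb, hb']
    simp [diagUnit]
  set D := diagUnit b b' with hD
  have hDp : D.val * corner B n = corner B n * D.val := by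
    simp [hD, diagUnit, corner, fromBlocks_multiply]
  set z := w' * (w * D)⁻¹ with hz
  have hqz : Units.map q z = 1 := by
    rw [hz, map_mul, map_inv, map_mul, hq, hq', hqD, diagUnit_mul, mul_inv_eq_one]
    congr 1 <;> group
  have hqz' : Units.map q z⁻¹ = 1 := by rw [map_inv, hqz, inv_one]
  have h1 : (1 : Matrix (Fin n ⊕ Fin n) (Fin n ⊕ Fin n) ℂ).map (algebraMap ℂ C) = 1 :=
    Matrix.map_one _ (map_zero _) (map_one _)
  obtain ⟨X, hX, hX'⟩ := exists_unitization h 1 z.val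
    ((congrArg Units.val hqz).trans h1.symm)
  obtain ⟨Y, hY, hY'⟩ := exists_unitization h 1 z⁻¹.val
    ((congrArg Units.val hqz').trans h1.symm)
  have hYX : Y * X = 1 := by
    apply unitization_ext h
    · rw [Matrix.map_mul, hX, hY, Matrix.map_one _ (map_zero _) (map_one _), one_mul]
    · rw [Matrix.map_mul, hX', hY', Matrix.map_one _ (map_zero _) (map_one _), Units.inv_mul]
  refine ⟨e * Y, X * e, ?_, ?_⟩
  · rw [Matrix.mul_assoc, ← Matrix.mul_assoc Y, hYX, Matrix.one_mul, hd.isIdempotentElem h]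
  · apply unitization_ext h
    · rw [Matrix.map_mul, Matrix.map_mul, Matrix.map_mul, hX, hY, hd.scalar, hd'.scalar,
        Matrix.one_mul, Matrix.mul_one, corner_idem]
    · rw [← Matrix.mul_assoc, Matrix.mul_assoc X, hd.isIdempotentElem h, Matrix.map_mul,
        Matrix.map_mul, hX', hY', hd.image, hd'.image]
      have hDp' : D.val * corner B n * D⁻¹.val = corner B n := by
        rw [hDp, mul_assoc, Units.mul_inv, mul_one]
      conv_lhs => rw [← hDp']
      have : z.val * (w.val * (D.val * corner B n * D⁻¹.val) * w⁻¹.val) * z⁻¹.val =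
          (z * (w * D)).val * corner B n * (z * (w * D))⁻¹.val := by
        simp only [_root_.mul_inv_rev, Units.val_mul, mul_assoc]
      rw [this, hz, inv_mul_cancel_right]

/-- The class `[w pₙ w⁻¹] - [pₙ] ∈ K₀(J)`, where `w` is a lift of `diag(u, u⁻¹)`; it does not depend
on `w` by `indexClass_eq`. -/
def indexClass (h : IsShortExact φ σ) {n : ℕ} (u : MatGL C n) : K₀ J :=
  let hd := (exists_isIndexData h u).choose_spec.choose_spec
  ⟨K₀₀.mk _ (hd.isIdempotentElem h) - K₀₀.mk _ (corner_idem _ n), by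
    rw [AddMonoidHom.mem_ker, map_sub, K₀₀.map_mk, K₀₀.map_mk, sub_eq_zero]
    congr 1
    exact hd.scalar.trans (corner_map _ n).symm⟩

theorem indexClass_eq (h : IsShortExact φ σ) {n : ℕ} {u : MatGL C n} {w} {e}
    (hd : IsIndexData φ σ u w e) : (indexClass h u : K₀ J).1 =
      K₀₀.mk e (hd.isIdempotentElem h) - K₀₀.mk _ (corner_idem _ n) := by
  have hd' := (exists_isIndexData h u).choose_spec.choose_spec
  change K₀₀.mk _ (hd'.isIdempotentElem h) - _ = _
  rw [K₀₀.mk_congr (hd'.isIdempotentElem h) (hd.isIdempotentElem h)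
    (hd'.algEquivalent h hd (by rw [inv_mul_cancel]; exact one_mem _))]

theorem indexClass_congr (h : IsShortExact φ σ) {n : ℕ} {u u' : MatGL C n}
    (hu : u⁻¹ * u' ∈ MatGL₀ C n) : indexClass h u = indexClass h u' := by
  obtain ⟨w, e, hd⟩ := exists_isIndexData h u
  obtain ⟨w', e', hd'⟩ := exists_isIndexData h u'
  apply Subtype.ext
  rw [indexClass_eq h hd, indexClass_eq h hd', K₀₀.mk_congr _ (hd'.isIdempotentElem h)
    (hd.algEquivalent h hd' hu)]

/-- The block matrix `diag(incl, incl)`. -/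
def incl₂ (R : Type*) [Ring R] {n m : ℕ} (h : n ≤ m) : Matrix (Fin m ⊕ Fin m) (Fin n ⊕ Fin n) R :=
  fromBlocks (incl R h) 0 0 (incl R h)

/-- The block matrix `diag(proj, proj)`. -/
def proj₂ (R : Type*) [Ring R] {n m : ℕ} (h : n ≤ m) : Matrix (Fin n ⊕ Fin n) (Fin m ⊕ Fin m) R :=
  fromBlocks (proj R h) 0 0 (proj R h)

theorem proj₂_mul_incl₂ (R : Type*) [Ring R] {n m : ℕ} (h : n ≤ m) :
    proj₂ R h * incl₂ R h = 1 := by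
  simp [proj₂, incl₂, fromBlocks_multiply, proj_mul_incl]

theorem incl₂_map {R S : Type*} [Ring R] [Ring S] (f : R →+* S) {n m : ℕ} (h : n ≤ m) :
    (incl₂ R h).map f = incl₂ S h := by
  simp [incl₂, fromBlocks_map, incl_map]

theorem proj₂_map {R S : Type*} [Ring R] [Ring S] (f : R →+* S) {n m : ℕ} (h : n ≤ m) :
    (proj₂ R h).map f = proj₂ S h := by
  simp [proj₂, fromBlocks_map, proj_map]

/-- The idempotent `diag(1 - incl proj, 0)`. -/
def compl₂ (R : Type*) [Ring R] {n m : ℕ} (h : n ≤ m) : Matrix (Fin m ⊕ Fin m) (Fin m ⊕ Fin m) R :=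
  fromBlocks (1 - incl R h * proj R h) 0 0 0

theorem compl₂_map {R S : Type*} [Ring R] [Ring S] (f : R →+* S) {n m : ℕ} (h : n ≤ m) :
    (compl₂ R h).map f = compl₂ S h := by
  simp [compl₂, fromBlocks_map, incl_map, proj_map, Matrix.map_sub f (map_sub f),
    Matrix.map_one f (map_zero f) (map_one f), Matrix.map_mul]

theorem proj_mul_compl (R : Type*) [Ring R] {n m : ℕ} (h : n ≤ m) :
    proj R h * (1 - incl R h * proj R h) = 0 := by
  rw [Matrix.mul_sub, ← Matrix.mul_assoc, proj_mul_incl]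
  simp

theorem compl_mul_incl (R : Type*) [Ring R] {n m : ℕ} (h : n ≤ m) :
    (1 - incl R h * proj R h) * incl R h = 0 := by
  rw [Matrix.sub_mul, Matrix.mul_assoc, proj_mul_incl]
  simp

theorem proj₂_mul_compl₂ (R : Type*) [Ring R] {n m : ℕ} (h : n ≤ m) :
    proj₂ R h * compl₂ R h = 0 := by
  simp [proj₂, compl₂, fromBlocks_multiply, proj_mul_compl]

theorem compl₂_mul_incl₂ (R : Type*) [Ring R] {n m : ℕ} (h : n ≤ m) :
    compl₂ R h * incl₂ R h = 0 := by
  simp [incl₂, compl₂, fromBlocks_multiply, compl_mul_incl]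

theorem compl₂_idem (R : Type*) [Ring R] {n m : ℕ} (h : n ≤ m) :
    IsIdempotentElem (compl₂ R h) := by
  refine isIdempotentElem_fromBlocks ?_ .zero
  rw [IsIdempotentElem, Matrix.mul_sub, ← Matrix.mul_assoc, compl_mul_incl]
  simp

theorem corner_eq_add (R : Type*) [Ring R] {n m : ℕ} (h : n ≤ m) :
    corner R m = incl₂ R h * corner R n * proj₂ R h + compl₂ R h := by
  simp [corner, incl₂, proj₂, compl₂, fromBlocks_multiply, fromBlocks_add]

theorem K₀₀.mk_stabilize {R : Type*} [Ring R] {n m : ℕ} (h : n ≤ m)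
    {e : Matrix (Fin n ⊕ Fin n) (Fin n ⊕ Fin n) R} {e' : Matrix (Fin m ⊕ Fin m) (Fin m ⊕ Fin m) R}
    (he : IsIdempotentElem e) (he' : IsIdempotentElem e')
    (heq : e' = incl₂ R h * e * proj₂ R h + compl₂ R h) :
    K₀₀.mk e' he' = K₀₀.mk e he + K₀₀.mk (compl₂ R h) (compl₂_idem R h) := by
  subst heq
  have h0 : e * proj₂ R h * (incl₂ R h * e) = e := by
    rw [Matrix.mul_assoc, ← Matrix.mul_assoc (proj₂ R h), proj₂_mul_incl₂, Matrix.one_mul, he.eq]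
  have h1 : AlgEquivalent e (incl₂ R h * e * proj₂ R h) := by
    refine ⟨e * proj₂ R h, incl₂ R h * e, h0, ?_⟩
    rw [Matrix.mul_assoc, ← Matrix.mul_assoc e, he.eq, Matrix.mul_assoc]
  have h2 : IsIdempotentElem (incl₂ R h * e * proj₂ R h) := by
    rw [IsIdempotentElem, Matrix.mul_assoc, ← Matrix.mul_assoc (proj₂ R h),
      ← Matrix.mul_assoc (proj₂ R h), proj₂_mul_incl₂, Matrix.one_mul, Matrix.mul_assoc,
      ← Matrix.mul_assoc e, he.eq, Matrix.mul_assoc]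
  rw [K₀₀.mk_add h2 (compl₂_idem R h) he' (by rw [Matrix.mul_assoc, proj₂_mul_compl₂, Matrix.mul_zero])
    (by rw [← Matrix.mul_assoc, ← Matrix.mul_assoc, compl₂_mul_incl₂, Matrix.zero_mul,
      Matrix.zero_mul]), K₀₀.mk_congr he h2 h1]

theorem indexClass_stabilize (h : IsShortExact φ σ) {n m : ℕ} (hnm : n ≤ m) (u : MatGL C n) :
    indexClass h (MatGL.stabilize hnm u) = indexClass h u := by
  obtain ⟨w, e, hd⟩ := exists_isIndexData h u
  let s : Matrix (Fin n ⊕ Fin n) (Fin n ⊕ Fin n) B →* Matrix (Fin m ⊕ Fin m) (Fin m ⊕ Fin m) B :=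
    { toFun := fun x => incl₂ B hnm * x * proj₂ B hnm + (1 - incl₂ B hnm * proj₂ B hnm)
      map_one' := by simp
      map_mul' := fun x y => (compress_mul (proj₂_mul_incl₂ B hnm) x y).symm }
  let w' := Units.map s w
  let e' := incl₂ (Unitization ℂ J) hnm * e * proj₂ (Unitization ℂ J) hnm +
    compl₂ (Unitization ℂ J) hnm
  have hd' : IsIndexData φ σ (MatGL.stabilize hnm u) w' e' := by
    refine ⟨?_, ?_, ?_⟩
    · change Matrix.map (incl₂ B hnm * w.val * proj₂ B hnm + (1 - incl₂ B hnm * proj₂ B hnm))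
        (σ : B →+* C) = _
      have hl : w.val.map (σ : B →+* C) = _ := hd.lift
      rw [Matrix.map_add _ (map_add _), Matrix.map_sub _ (map_sub _), Matrix.map_mul,
        Matrix.map_mul, Matrix.map_mul, incl₂_map, proj₂_map,
        Matrix.map_one _ (map_zero _) (map_one _), hl, ← fromBlocks_one]
      simp only [incl₂, proj₂, fromBlocks_multiply, ← map_inv]
      ext (i | i) (j | j) <;> simp [MatGL.stabilize, stabilize_apply, Matrix.one_apply]
    · rw [Matrix.map_add _ (map_add _), Matrix.map_mul, Matrix.map_mul, incl₂_map, proj₂_map,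
        compl₂_map, hd.scalar, ← corner_eq_add]
    · rw [Units.eq_mul_inv_iff_mul_eq, Matrix.map_add _ (map_add _), Matrix.map_mul,
        Matrix.map_mul, incl₂_map, proj₂_map, compl₂_map, hd.image]
      have hFG := proj₂_mul_incl₂ B hnm
      have hFG' : ∀ X : Matrix (Fin n ⊕ Fin n) (Fin m ⊕ Fin m) B,
          proj₂ B hnm * (incl₂ B hnm * X) = X := fun X => by
        rw [← Matrix.mul_assoc, hFG, Matrix.one_mul]
      have hcF' : ∀ X : Matrix (Fin n ⊕ Fin n) (Fin m ⊕ Fin m) B,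
          compl₂ B hnm * (incl₂ B hnm * X) = 0 := fun X => by
        rw [← Matrix.mul_assoc, compl₂_mul_incl₂, Matrix.zero_mul]
      have hw : ∀ X : Matrix (Fin n ⊕ Fin n) (Fin m ⊕ Fin m) B,
          w⁻¹.val * (w.val * X) = X := fun X => by
        rw [← Matrix.mul_assoc, Units.inv_mul, Matrix.one_mul]
      rw [corner_eq_add B hnm]
      change _ * (incl₂ B hnm * w.val * proj₂ B hnm + (1 - incl₂ B hnm * proj₂ B hnm)) =
        (incl₂ B hnm * w.val * proj₂ B hnm + (1 - incl₂ B hnm * proj₂ B hnm)) * _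
      simp only [Matrix.mul_add, Matrix.add_mul, Matrix.mul_sub, Matrix.sub_mul, Matrix.mul_one,
        Matrix.one_mul, Matrix.mul_assoc, hFG', hcF', hw, proj₂_mul_compl₂, Matrix.mul_zero]
      abel
  apply Subtype.ext
  rw [indexClass_eq h hd', indexClass_eq h hd, K₀₀.mk_stabilize hnm (hd.isIdempotentElem h) _ rfl,
    K₀₀.mk_stabilize hnm (corner_idem _ n) (corner_idem _ m) (corner_eq_add _ hnm),
    add_sub_add_right_eq_sub]

/-- The connecting (index) map `δ : K₁(C) → K₀(J)` of `0 → J → B → C → 0`,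
`[u]₁ ↦ [w pₙ w⁻¹]₀ - [pₙ]₀` where `w ∈ GL₂ₙ(B)` is any lift of `diag(u, u⁻¹)`. -/
def connectingMap (h : IsShortExact φ σ) : K₁ C → K₀ J :=
  DirectLimit.lift _ (fun n x => Quotient.lift (indexClass h (n := n))
    (fun _ _ huv => indexClass_congr h (QuotientGroup.leftRel_apply.1 huv)) x) fun n m hnm x => by
    induction x using QuotientGroup.induction_on with | _ u => ?_
    exact (indexClass_stabilize h hnm u).symm

theorem connectingMap_mk (h : IsShortExact φ σ) {n : ℕ} {u : MatGL C n} {w} {e}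
    (hd : IsIndexData φ σ u w e) : (connectingMap h (K₁.mk u)).1 =
      K₀₀.mk e (hd.isIdempotentElem h) - K₀₀.mk _ (corner_idem _ n) :=
  indexClass_eq h hd

end Connecting

section Diagonal

variable {B₂ B₃ C₂ C₃ : Type*} [CStarAlgebra B₂] [CStarAlgebra B₃] [CStarAlgebra C₂]
  [CStarAlgebra C₃]

/-- The fibre product `C₂ ⊕_{C₃} B₃ = {(c, b) | f c = g b}`. -/
def fiberProduct (f : C₂ →⋆ₐ[ℂ] C₃) (g : B₃ →⋆ₐ[ℂ] C₃) : StarSubalgebra ℂ (C₂ × B₃) :=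
  StarAlgHom.equalizer (f.comp (StarAlgHom.fst ℂ C₂ B₃)) (g.comp (StarAlgHom.snd ℂ C₂ B₃))

/-- `σ_diag = σ ⊕ η : B₂ → C₂ ⊕_{C₃} B₃`. -/
def diagonalMap (f : C₂ →⋆ₐ[ℂ] C₃) (g : B₃ →⋆ₐ[ℂ] C₃) (σ : B₂ →⋆ₐ[ℂ] C₂) (η : B₂ →⋆ₐ[ℂ] B₃)
    (h : ∀ b, f (σ b) = g (η b)) : B₂ →⋆ₐ[ℂ] fiberProduct f g :=
  StarAlgHom.codRestrict (σ.prod η) (fiberProduct f g) h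

end Diagonal
end
end KTheory

/-!
The main point is exactness of `K₁(B) → K₁(C) → K₀(J)` at `K₁(C)` for an extension
`0 → J → B → C → 0`, in the sharp form of `connectingMap_mk_eq_zero_iff`: if the connecting map
kills the class of `u ∈ GLₙ(C)`, then `diag(u, 1)` itself, and not only a matrix homotopic to it,
lifts to an invertible matrix over `B`. Indeed, let `w` lift `diag(u, u⁻¹)` and let `e` be
`w pₙ w⁻¹` seen over `J~`. If `[e]₀ = [pₙ]₀`, then `diag(e, 1ₖ)` is equivalent to `diag(pₙ, 1ₖ)` for
some `k` (`K₀₀.exists_algEquivalent_of_mk_eq`), so `diag(e, 1ₖ) = a b` with `b a = 1` of size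
`n + k`. After a correction by an invertible scalar matrix the scalar part of `b` is the standard
projection onto the range of `diag(pₙ, 1ₖ)` (`exists_factorization`). Then `b diag(w, 1)`, restricted
to that range, is invertible over `B` and maps to `diag(u, 1ₖ)`.

The connecting map is natural (`map_connectingMap_mk`), so `K₀(r) (δ [σ(T)]₁)` is the image of
`[ηC(σ(T))]₁` under the connecting map of the column `0 → A₃ → B₃ → C₃ → 0`. It vanishes if and only
if some `diag(ηC(σ(T)), 1)` lifts along `γ` to an invertible matrix `v` over `B₃`. In that case
`(diag(σ(T), 1), v)` is a matrix over the fibre product `C₂ ⊕_{C₃} B₃`, and it lifts to a matrix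
`T'` over `B₂` since `σ_diag` is surjective; this is where surjectivity of `B₁ → C₁` enters
(`exists_lift_of_eq`).
-/

namespace KTheory
open Matrix

/-! ### Stabilization of invertible matrices and of idempotents -/

theorem stabilize_eq_reindex {R : Type*} [Ring R] {n k : ℕ} (u : Matrix (Fin n) (Fin n) R) :
    stabilize (Nat.le_add_right n k) u =
      reindex finSumFinEquiv finSumFinEquiv (fromBlocks u 0 0 (1 : Matrix (Fin k) (Fin k) R)) := by
  have hne : ∀ (i : Fin n) (j : Fin k), Fin.castAdd k i ≠ Fin.natAdd n j := fun i j h => by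
    have := congrArg Fin.val h
    simp at this
    omega
  have hcast : ∀ i : Fin n, Fin.castLE (Nat.le_add_right n k) i = Fin.castAdd k i := fun _ => rfl
  ext i j
  refine Fin.addCases (fun i => ?_) (fun i => ?_) i <;>
    refine Fin.addCases (fun j => ?_) (fun j => ?_) j <;>
    simp [stabilize_apply, incl, proj, Matrix.mul_apply, Matrix.one_apply, hcast, hne, (hne _ _).symm]

/-- Equality in the Grothendieck group means equivalence after adding a common idempotent `g`; a
further addition of `1 - g` turns `g` into an identity matrix. -/
theorem K₀₀.exists_algEquivalent_of_mk_eq {R : Type*} [Ring R] {ι κ : Type*} [Fintype ι]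
    [Fintype κ] {e : Matrix ι ι R} {f : Matrix κ κ R} {he : IsIdempotentElem e}
    {hf : IsIdempotentElem f} (h : K₀₀.mk e he = K₀₀.mk f hf) :
    ∃ k : ℕ, AlgEquivalent (fromBlocks e 0 0 (1 : Matrix (Fin k) (Fin k) R))
      (fromBlocks f 0 0 (1 : Matrix (Fin k) (Fin k) R)) := by
  obtain ⟨⟨c, _⟩, hc⟩ := (AddLocalization.addMonoidOf (⊤ : AddSubmonoid (V R))).eq_iff_exists.1 h
  revert hc
  refine V.ind (p := fun c => c + V.mk e he = c + V.mk f hf → _) (fun k g hg hc => ⟨k, ?_⟩) c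
  have h1 : V.mk (1 : Matrix (Fin k) (Fin k) R) .one = V.mk g hg + V.mk (1 - g) hg.one_sub := by
    rw [V.mk_add_mk, V.mk_eq_mk]
    simpa using AlgEquivalent.add hg hg.one_sub hg.mul_one_sub_self hg.one_sub_mul_self
  rw [← V.mk_eq_mk (he := isIdempotentElem_fromBlocks he .one)
    (hf := isIdempotentElem_fromBlocks hf .one), ← V.mk_add_mk he .one, ← V.mk_add_mk hf .one, h1,
    ← add_assoc, ← add_assoc, add_comm (V.mk e he), add_comm (V.mk f hf), hc]

theorem K₁.mk_stabilize {R : Type*} [Ring R] [TopologicalSpace R] [IsTopologicalRing R] {n m : ℕ}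
    (h : n ≤ m) (u : MatGL R n) : K₁.mk (MatGL.stabilize h u) = K₁.mk u :=
  (DirectLimit.eq_of_le (F := fun n : ℕ => MatGL R n ⧸ MatGL₀ R n)
    (f := fun _ _ h => compStab (R := R) h) ⟨n, QuotientGroup.mk u⟩ m h).symm

/-! ### The range of `diag(pₙ, 1ₖ)` -/

section Corner

variable (R : Type*) [Ring R] (n k : ℕ)

/-- The inclusion of `Rⁿ ⊕ Rᵏ` into `(Rⁿ ⊕ Rⁿ) ⊕ Rᵏ` as the range of `diag(pₙ, 1ₖ)`. -/
def cornerIncl : Matrix ((Fin n ⊕ Fin n) ⊕ Fin k) (Fin n ⊕ Fin k) R :=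
  fromBlocks (fromRows 1 0) 0 0 1

/-- The projection of `(Rⁿ ⊕ Rⁿ) ⊕ Rᵏ` onto `Rⁿ ⊕ Rᵏ`, the range of `diag(pₙ, 1ₖ)`. -/
def cornerProj : Matrix (Fin n ⊕ Fin k) ((Fin n ⊕ Fin n) ⊕ Fin k) R :=
  fromBlocks (fromCols 1 0) 0 0 1

theorem cornerProj_mul_cornerIncl : cornerProj R n k * cornerIncl R n k = 1 := by
  simp [cornerProj, cornerIncl, fromBlocks_multiply, fromCols_mul_fromRows]

theorem cornerIncl_mul_cornerProj :
    cornerIncl R n k * cornerProj R n k = fromBlocks (corner R n) 0 0 1 := by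
  have h : fromCols (fromRows (1 : Matrix (Fin n) (Fin n) R) (0 : Matrix (Fin n) (Fin n) R))
      (0 : Matrix (Fin n ⊕ Fin n) (Fin n) R) = fromBlocks 1 0 0 0 := by
    ext (i | i) (j | j) <;> simp
  simp [cornerProj, cornerIncl, fromBlocks_multiply, corner, h]

variable {R} {S : Type*} [Ring S] (f : R →+* S)

theorem cornerIncl_map : (cornerIncl R n k).map f = cornerIncl S n k := by
  ext ((i | i) | i) (j | j) <;> simp [cornerIncl, Matrix.one_apply, apply_ite f]

theorem cornerProj_map : (cornerProj R n k).map f = cornerProj S n k := by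
  ext (i | i) ((j | j) | j) <;> simp [cornerProj, Matrix.one_apply, apply_ite f]

end Corner

/-- An idempotent with scalar part `diag(pₙ, 1ₖ)` that is equivalent to `diag(pₙ, 1ₖ)` factors
through a free module of rank `n + k` in such a way that one of the two factors has the standard
scalar part. -/
theorem exists_factorization {J : Type*} [NonUnitalCStarAlgebra J] {n k : ℕ}
    {E : Matrix ((Fin n ⊕ Fin n) ⊕ Fin k) ((Fin n ⊕ Fin n) ⊕ Fin k) (Unitization ℂ J)}
    (hE : IsIdempotentElem E) (hs : E.map (scalarHom J) = fromBlocks (corner ℂ n) 0 0 1)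
    (h : AlgEquivalent E (fromBlocks (corner _ n) 0 0 (1 : Matrix (Fin k) (Fin k) _))) :
    ∃ (a : Matrix ((Fin n ⊕ Fin n) ⊕ Fin k) (Fin n ⊕ Fin k) (Unitization ℂ J))
      (b : Matrix (Fin n ⊕ Fin k) ((Fin n ⊕ Fin n) ⊕ Fin k) (Unitization ℂ J)),
      a * b = E ∧ b * a = 1 ∧ b.map (scalarHom J) = cornerProj ℂ n k := by
  obtain ⟨a, b, hab, hba⟩ := AlgEquivalent.trans hE .one h
    ⟨cornerIncl _ n k, cornerProj _ n k, cornerIncl_mul_cornerProj _ n k,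
      cornerProj_mul_cornerIncl _ n k⟩
  have hab' : a.map (scalarHom J) * b.map (scalarHom J) = cornerIncl ℂ n k * cornerProj ℂ n k := by
    rw [← Matrix.map_mul, hab, hs, cornerIncl_mul_cornerProj]
  have hba' : b.map (scalarHom J) * a.map (scalarHom J) = 1 := by
    rw [← Matrix.map_mul, hba, Matrix.map_one _ (map_zero _) (map_one _)]
  -- The scalar matrix `x` and its inverse `y` are used to correct the scalar part of `b`.
  set x := cornerProj ℂ n k * a.map (scalarHom J) with hx
  set y := b.map (scalarHom J) * cornerIncl ℂ n k with hy
  have hxy : x * y = 1 := by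
    rw [hx, hy, Matrix.mul_assoc, ← Matrix.mul_assoc (a.map _), hab', ← Matrix.mul_assoc,
      ← Matrix.mul_assoc, cornerProj_mul_cornerIncl, Matrix.one_mul, cornerProj_mul_cornerIncl]
  have hyx : y * x = 1 := by
    rw [hx, hy, Matrix.mul_assoc, ← Matrix.mul_assoc (cornerIncl _ _ _), ← hab',
      Matrix.mul_assoc, hba', Matrix.mul_one, hba']
  let ι := algebraMap ℂ (Unitization ℂ J)
  have hι : ∀ z : Matrix (Fin n ⊕ Fin k) (Fin n ⊕ Fin k) ℂ, (z.map ι).map (scalarHom J) = z :=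
    fun z => rfl
  have hone : (1 : Matrix (Fin n ⊕ Fin k) (Fin n ⊕ Fin k) ℂ).map ι = 1 :=
    Matrix.map_one _ (map_zero _) (map_one _)
  refine ⟨a * y.map ι, x.map ι * b, ?_, ?_, ?_⟩
  · rw [Matrix.mul_assoc, ← Matrix.mul_assoc (y.map ι), ← Matrix.map_mul, hyx, hone,
      Matrix.one_mul, hab]
  · rw [Matrix.mul_assoc, ← Matrix.mul_assoc b, hba, Matrix.one_mul, ← Matrix.map_mul, hxy, hone]
  · rw [Matrix.map_mul, hι, hx, Matrix.mul_assoc, hab', ← Matrix.mul_assoc,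
      cornerProj_mul_cornerIncl, Matrix.one_mul]

/-! ### Exactness at `K₁(C)` -/

/-- The homomorphism `GLₙ(R) → GLₙ(S)` that applies a ring homomorphism entrywise. -/
def MatGL.map {R S : Type*} [Ring R] [TopologicalSpace R] [IsTopologicalRing R] [Ring S]
    [TopologicalSpace S] [IsTopologicalRing S] (f : R →+* S) (n : ℕ) : MatGL R n →* MatGL S n :=
  Units.map (f.mapMatrix : Matrix (Fin n) (Fin n) R →+* Matrix (Fin n) (Fin n) S).toMonoidHom

section Exact

variable {J B C : Type*} [NonUnitalCStarAlgebra J] [CStarAlgebra B] [CStarAlgebra C]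
  {φ : J →⋆ₙₐ[ℂ] B} {σ : B →⋆ₐ[ℂ] C}

theorem unitizationHom_map_map (h : IsShortExact φ σ) {ι κ : Type*}
    (X : Matrix ι κ (Unitization ℂ J)) :
    (X.map (unitizationHom φ)).map σ = (X.map (scalarHom J)).map (algebraMap ℂ C) := by
  ext i j
  change σ (algebraMap ℂ B (X i j).fst + φ (X i j).snd) = algebraMap ℂ C (X i j).fst
  rw [map_add, (h.exact _).2 ⟨_, rfl⟩, add_zero, AlgHomClass.commutes]

/-- If the idempotent `e = w pₙ w⁻¹` has the same class as `pₙ`, then `diag(u, 1)` lifts to an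
invertible matrix. -/
theorem IsIndexData.exists_lift_of_mk_eq (h : IsShortExact φ σ) {n : ℕ} {u : MatGL C n} {w} {e}
    (hd : IsIndexData φ σ u w e)
    (he : K₀₀.mk e (hd.isIdempotentElem h) = K₀₀.mk (corner _ n) (corner_idem _ n)) :
    ∃ (k : ℕ) (v : MatGL B (n + k)), v.val.map σ = stabilize (Nat.le_add_right n k) u.val := by
  obtain ⟨k, hk⟩ := K₀₀.exists_algEquivalent_of_mk_eq he
  obtain ⟨a, b, hab, hba, hb⟩ := exists_factorization
    (isIdempotentElem_fromBlocks (hd.isIdempotentElem h) .one) (by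
      rw [fromBlocks_map, hd.scalar, Matrix.map_one _ (map_zero _) (map_one _)]
      simp) hk
  set a' := a.map (unitizationHom φ) with ha'
  set b' := b.map (unitizationHom φ) with hb'
  set W := fromBlocks w.val 0 0 (1 : Matrix (Fin k) (Fin k) B) with hW
  set W' := fromBlocks w⁻¹.val 0 0 (1 : Matrix (Fin k) (Fin k) B) with hW'
  have hWW' : W * W' = 1 := by simp [hW, hW', fromBlocks_multiply]
  have hW'W : W' * W = 1 := by simp [hW, hW', fromBlocks_multiply]
  have hba' : b' * a' = 1 := by
    rw [← Matrix.map_mul, hba, Matrix.map_one _ (map_zero _) (map_one _)]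
  have hab' : a' * b' = W * (cornerIncl B n k * cornerProj B n k) * W' := by
    rw [← Matrix.map_mul, hab, fromBlocks_map, hd.image, cornerIncl_mul_cornerProj, hW, hW',
      fromBlocks_multiply, fromBlocks_multiply, Matrix.map_one _ (map_zero _) (map_one _)]
    simp
  -- `b'` restricts to an isomorphism from the range of `W diag(pₙ, 1ₖ) W⁻¹` onto `Bⁿ⁺ᵏ`.
  let v : (Matrix (Fin n ⊕ Fin k) (Fin n ⊕ Fin k) B)ˣ :=
    { val := b' * (W * cornerIncl B n k)
      inv := cornerProj B n k * W' * a'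
      val_inv := by
        calc _ = b' * (W * (cornerIncl B n k * cornerProj B n k) * W') * a' := by
              simp only [Matrix.mul_assoc]
          _ = (b' * a') * (b' * a') := by rw [← hab']; simp only [Matrix.mul_assoc]
          _ = 1 := by rw [hba', Matrix.one_mul]
      inv_val := by
        calc _ = cornerProj B n k * W' * (a' * b') * (W * cornerIncl B n k) := by
              simp only [Matrix.mul_assoc]
          _ = cornerProj B n k * (W' * W) * (cornerIncl B n k * cornerProj B n k) * (W' * W) *
                cornerIncl B n k := by rw [hab']; simp only [Matrix.mul_assoc]
          _ = (cornerProj B n k * cornerIncl B n k) * (cornerProj B n k * cornerIncl B n k) := by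
              rw [hW'W]; simp only [Matrix.mul_assoc, Matrix.mul_one]
          _ = 1 := by rw [cornerProj_mul_cornerIncl, Matrix.one_mul] }
  have hbσ : b'.map σ = cornerProj C n k := by
    rw [hb', unitizationHom_map_map h, hb, cornerProj_map]
  have hWσ : W.map σ = fromBlocks (fromBlocks u.val 0 0 u⁻¹.val) 0 0 1 := by
    rw [hW, fromBlocks_map, hd.lift, Matrix.map_one _ (map_zero _) (map_one _)]
    simp
  have hv : v.val.map σ = fromBlocks u.val 0 0 1 := by
    change Matrix.map (b' * (W * cornerIncl B n k)) (σ : B →+* C) = _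
    rw [Matrix.map_mul, Matrix.map_mul, cornerIncl_map]
    change b'.map σ * (W.map σ * _) = _
    rw [hbσ, hWσ, cornerProj, cornerIncl]
    simp [fromBlocks_multiply, fromBlocks_mul_fromRows, fromCols_mul_fromRows]
  refine ⟨k, Units.map (reindexAlgEquiv ℤ B finSumFinEquiv).toMulEquiv.toMonoidHom v, ?_⟩
  change (reindex finSumFinEquiv finSumFinEquiv v.val).map σ = _
  rw [stabilize_eq_reindex, ← hv]
  rfl

/-- If `u` lifts to an invertible matrix `v`, then `diag(v, v⁻¹)` commutes with `pₙ`, so that `pₙ`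
itself computes the index class of `u`. -/
theorem isIndexData_of_lift {n : ℕ} {u : MatGL C n} {v : MatGL B n}
    (hv : MatGL.map (σ : B →+* C) n v = u) :
    IsIndexData φ σ u (diagUnit v v⁻¹) (corner (Unitization ℂ J) n) where
  lift := by
    subst hv
    rw [← map_inv]
    change (fromBlocks v.val 0 0 v⁻¹.val).map σ = _
    rw [fromBlocks_map]
    simp only [Matrix.map_zero _ (map_zero σ)]
    rfl
  scalar := corner_map _ n
  image := by
    rw [corner_map, Units.eq_mul_inv_iff_mul_eq]
    simp [diagUnit, corner, fromBlocks_multiply]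

/-- Exactness of `K₁(B) → K₁(C) → K₀(J)` at `K₁(C)`, for classes of matrices: a class in the
kernel lifts to an invertible matrix exactly, and not only up to homotopy, after stabilization. -/
theorem connectingMap_mk_eq_zero_iff (h : IsShortExact φ σ) {n : ℕ} (u : MatGL C n) :
    connectingMap h (K₁.mk u) = 0 ↔ ∃ (k : ℕ) (v : MatGL B (n + k)),
      MatGL.map (σ : B →+* C) (n + k) v = MatGL.stabilize (Nat.le_add_right n k) u := by
  constructor
  · intro h0
    obtain ⟨w, e, hd⟩ := exists_isIndexData h u
    have h1 := connectingMap_mk h hd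
    rw [h0] at h1
    obtain ⟨k, v, hv⟩ := hd.exists_lift_of_mk_eq h (sub_eq_zero.1 h1.symm)
    exact ⟨k, v, Units.ext hv⟩
  · rintro ⟨k, v, hv⟩
    rw [← K₁.mk_stabilize (Nat.le_add_right n k)]
    apply Subtype.ext
    rw [connectingMap_mk h (isIndexData_of_lift hv)]
    exact sub_self _

/-! ### Naturality of the connecting map -/

variable {J' B' C' : Type*} [NonUnitalCStarAlgebra J'] [CStarAlgebra B'] [CStarAlgebra C']
  {φ' : J' →⋆ₙₐ[ℂ] B'} {σ' : B' →⋆ₐ[ℂ] C'}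

theorem toProd_starMap (f : J →⋆ₙₐ[ℂ] J') (x : Unitization ℂ J) :
    (Unitization.starMap f x).toProd = (x.fst, f x.snd) := by
  induction x with
  | _ a x => ext <;> simp [Unitization.algebraMap_eq_inl]

theorem IsIndexData.map (f : J →⋆ₙₐ[ℂ] J') (g : B →⋆ₐ[ℂ] B') (k : C →⋆ₐ[ℂ] C')
    (hfg : ∀ x, φ' (f x) = g (φ x)) (hgk : ∀ b, σ' (g b) = k (σ b))
    {n : ℕ} {u : MatGL C n} {w} {e} (hd : IsIndexData φ σ u w e) :
    IsIndexData φ' σ' (MatGL.map (k : C →+* C') n u)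
      (Units.map ((g : B →+* B').mapMatrix : Matrix (Fin n ⊕ Fin n) (Fin n ⊕ Fin n) B →+*
        Matrix (Fin n ⊕ Fin n) (Fin n ⊕ Fin n) B').toMonoidHom w)
      (e.map (Unitization.starMap f : Unitization ℂ J →+* Unitization ℂ J')) where
  lift := by
    have h1 : (w.val.map g).map σ' = (w.val.map σ).map k := by
      ext i j
      exact hgk _
    refine h1.trans ?_
    rw [hd.lift, fromBlocks_map, ← map_inv]
    simp only [Matrix.map_zero _ (map_zero k)]
    rfl
  scalar := by
    rw [← hd.scalar]
    ext i j
    exact congrArg Prod.fst (toProd_starMap f (e i j))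
  image := by
    have h1 : (e.map (Unitization.starMap f : Unitization ℂ J →+* Unitization ℂ J')).map
        (unitizationHom φ') = (e.map (unitizationHom φ)).map (g : B →+* B') := by
      ext i j
      change algebraMap ℂ B' (Unitization.starMap f (e i j)).fst +
        φ' (Unitization.starMap f (e i j)).snd =
        g (algebraMap ℂ B (e i j).fst + φ (e i j).snd)
      rw [toProd_starMap, map_add, AlgHomClass.commutes, hfg]
    rw [h1, hd.image, Matrix.map_mul, Matrix.map_mul, corner_map]
    rfl

/-- Naturality of the connecting map. -/
theorem map_connectingMap_mk (h : IsShortExact φ σ) (h' : IsShortExact φ' σ')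
    (f : J →⋆ₙₐ[ℂ] J') (g : B →⋆ₐ[ℂ] B') (k : C →⋆ₐ[ℂ] C')
    (hfg : ∀ x, φ' (f x) = g (φ x)) (hgk : ∀ b, σ' (g b) = k (σ b)) {n : ℕ} (u : MatGL C n) :
    K₀.map f (connectingMap h (K₁.mk u)) =
      connectingMap h' (K₁.mk (MatGL.map (k : C →+* C') n u)) := by
  obtain ⟨w, e, hd⟩ := exists_isIndexData h u
  apply Subtype.ext
  rw [connectingMap_mk h' (hd.map f g k hfg hgk)]
  change K₀₀.map _ (connectingMap h (K₁.mk u)).1 = _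
  rw [connectingMap_mk h hd, map_sub, K₀₀.map_mk, K₀₀.map_mk]
  congr 2
  exact corner_map _ n

end Exact

/-! ### The fibre product -/

/-- In a morphism of extensions from `μB, η` to `μC, ηC` that is surjective on the kernels, the map
`(σ, η)` to the fibre product of `ηC` and `γ` is surjective. -/
theorem exists_lift_of_eq {B₁ B₂ B₃ C₁ C₂ C₃ : Type*} [AddGroup B₂] [AddGroup B₃] [Zero C₁]
    [AddGroup C₂] [AddGroup C₃] {F G H : Type*} [FunLike F B₂ B₃] [AddMonoidHomClass F B₂ B₃]
    [FunLike G C₂ C₃] [AddMonoidHomClass G C₂ C₃] [FunLike H B₂ C₂] [AddMonoidHomClass H B₂ C₂]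
    {μB : B₁ → B₂} {η : F} {μC : C₁ → C₂} {ηC : G} {α : B₁ → C₁} {σ : H} {γ : B₃ → C₃}
    (hB : IsShortExact μB η) (hC : IsShortExact μC ηC) (hα : Function.Surjective α)
    (sq₃ : ∀ b, σ (μB b) = μC (α b)) (sq₄ : ∀ b, ηC (σ b) = γ (η b))
    {c : C₂} {b : B₃} (hcb : ηC c = γ b) : ∃ x, σ x = c ∧ η x = b := by
  obtain ⟨x, rfl⟩ := hB.surjective b
  obtain ⟨y, hy⟩ := (hC.exact (c - σ x)).1 (by rw [map_sub, hcb, sq₄, sub_self])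
  obtain ⟨z, rfl⟩ := hα y
  refine ⟨μB z + x, ?_, ?_⟩
  · rw [map_add, sq₃, hy, sub_add_cancel]
  · rw [map_add, (hB.exact _).2 ⟨z, rfl⟩, zero_add]

theorem isUnit_map_diagonalMap {B₂ B₃ C₂ C₃ : Type*} [CStarAlgebra B₂] [CStarAlgebra B₃]
    [CStarAlgebra C₂] [CStarAlgebra C₃] {f : C₂ →⋆ₐ[ℂ] C₃} {g : B₃ →⋆ₐ[ℂ] C₃} {σ : B₂ →⋆ₐ[ℂ] C₂}
    {η : B₂ →⋆ₐ[ℂ] B₃} (h : ∀ b, f (σ b) = g (η b)) {ι : Type*} [Fintype ι] [DecidableEq ι]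
    {T : Matrix ι ι B₂} (hσ : IsUnit (T.map σ)) (hη : IsUnit (T.map η)) :
    IsUnit (T.map (diagonalMap f g σ η h)) := by
  obtain ⟨s, hs⟩ := hσ
  obtain ⟨t, ht⟩ := hη
  have hst : Units.map ((f : C₂ →+* C₃).mapMatrix : Matrix ι ι C₂ →+* Matrix ι ι C₃).toMonoidHom s =
      Units.map ((g : B₃ →+* C₃).mapMatrix : Matrix ι ι B₃ →+* Matrix ι ι C₃).toMonoidHom t := by
    refine Units.ext (Matrix.ext fun i j => ?_)
    change f (s.val i j) = g (t.val i j)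
    rw [hs, ht]
    exact h _
  -- The two inverses have the same image over `C₃`, so together they are a matrix over the fibre
  -- product.
  have hinv : ∀ i j, f (s⁻¹.val i j) = g (t⁻¹.val i j) := fun i j => by
    have h1 : (s⁻¹.val).map f = (t⁻¹.val).map g :=
      congrArg Units.val (congrArg Inv.inv hst)
    exact congrFun (congrFun h1 i) j
  let R : Matrix ι ι (fiberProduct f g) := fun i j => ⟨(s⁻¹.val i j, t⁻¹.val i j), hinv i j⟩
  let p₁ : fiberProduct f g →+* C₂ := (RingHom.fst C₂ B₃).comp (fiberProduct f g).subtype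
  let p₂ : fiberProduct f g →+* B₃ := (RingHom.snd C₂ B₃).comp (fiberProduct f g).subtype
  have hext : ∀ X Y : Matrix ι ι (fiberProduct f g),
      X.map p₁ = Y.map p₁ → X.map p₂ = Y.map p₂ → X = Y := fun X Y h1 h2 => by
    ext i j
    · exact congrFun (congrFun h1 i) j
    · exact congrFun (congrFun h2 i) j
  set D := T.map (diagonalMap f g σ η h) with hD
  have hD₁ : D.map p₁ = s.val := hs.symm
  have hD₂ : D.map p₂ = t.val := ht.symm
  have hR₁ : R.map p₁ = s⁻¹.val := rfl
  have hR₂ : R.map p₂ = t⁻¹.val := rfl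
  refine ⟨⟨D, R, hext _ _ ?_ ?_, hext _ _ ?_ ?_⟩, rfl⟩ <;>
    simp only [Matrix.map_mul, hD₁, hD₂, hR₁, hR₂, Matrix.map_one _ (map_zero _) (map_one _),
      Units.mul_inv, Units.inv_mul]

end KTheory

theorem mainTheorem4
    {A₁ A₂ A₃ B₁ B₂ B₃ C₁ C₂ C₃ : Type*}
    [NonUnitalCStarAlgebra A₁] [NonUnitalCStarAlgebra A₂] [NonUnitalCStarAlgebra A₃]
    [NonUnitalCStarAlgebra B₁] [CStarAlgebra B₂] [CStarAlgebra B₃]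
    [NonUnitalCStarAlgebra C₁] [CStarAlgebra C₂] [CStarAlgebra C₃]
    -- rows
    (μA : A₁ →⋆ₙₐ[ℂ] A₂) (r : A₂ →⋆ₙₐ[ℂ] A₃)
    (μB : B₁ →⋆ₙₐ[ℂ] B₂) (η : B₂ →⋆ₐ[ℂ] B₃)
    (μC : C₁ →⋆ₙₐ[ℂ] C₂) (ηC : C₂ →⋆ₐ[ℂ] C₃)
    -- columns
    (ι₁ : A₁ →⋆ₙₐ[ℂ] B₁) (α : B₁ →⋆ₙₐ[ℂ] C₁)
    (ι₂ : A₂ →⋆ₙₐ[ℂ] B₂) (σ : B₂ →⋆ₐ[ℂ] C₂)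
    (ι₃ : A₃ →⋆ₙₐ[ℂ] B₃) (γ : B₃ →⋆ₐ[ℂ] C₃)
    -- exactness of the rows and of the columns
    (_hA : KTheory.IsShortExact μA r) (_hB : KTheory.IsShortExact μB η)
    (_hC : KTheory.IsShortExact μC ηC)
    (_h₁ : KTheory.IsShortExact ι₁ α) (h₂ : KTheory.IsShortExact ι₂ σ)
    (_h₃ : KTheory.IsShortExact ι₃ γ)
    -- commutativity of the four squares
    (_sq₁ : ∀ a, ι₂ (μA a) = μB (ι₁ a)) (_sq₂ : ∀ a, ι₃ (r a) = η (ι₂ a))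
    (_sq₃ : ∀ b, σ (μB b) = μC (α b)) (sq₄ : ∀ b, ηC (σ b) = γ (η b))
    -- a `σ`-invertible element
    (T : B₂) (hT : IsUnit (σ T)) :
    (KTheory.K₀.map r (KTheory.connectingMap h₂ (KTheory.K₁.ofUnit hT.unit)) = 0 ↔
      ∃ N : ℕ, 0 < N ∧ ∃ (T' : Matrix (Fin N) (Fin N) B₂) (hT' : IsUnit (T'.map σ)),
        KTheory.K₁.ofUnit hT.unit = KTheory.K₁.mk hT'.unit ∧ IsUnit (T'.map η)) ∧
    (∀ (N : ℕ) (T' : Matrix (Fin N) (Fin N) B₂), IsUnit (T'.map σ) → IsUnit (T'.map η) →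
      IsUnit (T'.map (KTheory.diagonalMap ηC γ σ η sq₄))) := by
  open KTheory in
  have hnat {n : ℕ} (u : MatGL C₂ n) := map_connectingMap_mk h₂ _h₃ r η ηC _sq₂
    (fun b => (sq₄ b).symm) u
  refine ⟨⟨fun h0 => ?_, ?_⟩, fun N T' => isUnit_map_diagonalMap sq₄⟩
  · -- `T'` lifts the pair `(diag(σ(T), 1), v)` in the fibre product.
    rw [K₁.ofUnit, hnat, connectingMap_mk_eq_zero_iff] at h0
    obtain ⟨k, v, hv⟩ := h0
    rw [K₁.ofUnit]
    set u : MatGL C₂ 1 := Units.map _ hT.unit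
    set c := MatGL.stabilize (Nat.le_add_right 1 k) u with hc
    have hcv : ∀ i j, ηC (c.val i j) = γ (v.val i j) := fun i j => by
      have h1 : c.val.map (ηC : C₂ →+* C₃) = v.val.map γ :=
        (stabilize_map _ _ _).trans (congrArg Units.val hv).symm
      exact congrFun (congrFun h1 i) j
    choose T' hσ hη using fun i j =>
      exists_lift_of_eq _hB _hC _h₁.surjective _sq₃ sq₄ (hcv i j)
    have hσ' : (Matrix.of T').map σ = c.val := Matrix.ext hσ
    have hη' : (Matrix.of T').map η = v.val := Matrix.ext hη
    have hT' : IsUnit ((Matrix.of T').map σ) := hσ' ▸ c.isUnit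
    refine ⟨1 + k, by omega, Matrix.of T', hT', ?_, hη' ▸ v.isUnit⟩
    rw [show hT'.unit = c from Units.ext hσ', hc, K₁.mk_stabilize]
  · rintro ⟨N, -, T', hT', hTT', hη⟩
    -- No stabilization is needed: `η(T')` lifts `ηC(σ(T'))`.
    rw [hTT', hnat, connectingMap_mk_eq_zero_iff]
    refine ⟨0, hη.unit, Units.ext ?_⟩
    refine Eq.trans ?_ (stabilize_self _).symm
    change (T'.map η).map γ = (T'.map σ).map ηC
    ext i j
    exact (sq₄ _).symm
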